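/- Let $0<\alpha<2$, $m>0$, and let $\beta,\gamma>0$ satisfy $2\gamma=\alpha(\beta+\gamma)$. For $c>0$ put $$\Psi_c^{\alpha}(u)=\bigl(2c^{\beta}u+(mc^{\gamma})^{2/\alpha}\bigr)^{\alpha/2}-mc^{\gamma},\qquad u\ge 0 .$$ Let $(\Omega,\mathcal F,P)$ be a probability space and, for every $c>0$, let $(T_t^c)_{t\ge 0}$ be an $\alpha/2$-relativistic subordinator with parameter $c$ on it, that is, a subordinator (a real-valued Lévy process with $T_0^c=0$ and nondecreasing paths, almost surely) such that $$\mathbb E_P\bigl[e^{-uT_t^c}\bigr]=e^{-t\Psi_c^{\alpha}(u)}\qquad\text{for all } t,u\ge 0 .$$ Then for every $t\ge 0$ and every integer $n\ge 1$ the random variable $\bigl|T_t^c-\alpha t/m^{2/\alpha-1}\bigr|^n$ is $P$-integrable for every $c>0$, and $$\lim_{c\to\infty}\mathbb E_P\left[\left|T_t^c-\frac{\alpha t}{m^{2/\alpha-1}}\right|^n\right]=0 .$$ -/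

import Mathlib

open MeasureTheory ProbabilityTheory Filter Topology
open scoped NNReal

namespace RelSub

/-- A path `[0, ∞) → ℝ` is càdlàg: right continuous, with left limits. -/
def IsCadlag (x : ℝ≥0 → ℝ) : Prop :=
  (∀ t, ContinuousWithinAt x (Set.Ici t) t) ∧ ∀ t, ∃ l : ℝ, Tendsto x (𝓝[<] t) (𝓝 l)

/-- Real-valued Lévy process `(X t)`, `t ≥ 0`, on a probability space. -/
structure IsLevyProcess {Ω : Type*} [MeasurableSpace Ω] (X : ℝ≥0 → Ω → ℝ)
    (P : Measure Ω) : Prop where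
  measurable : ∀ t, Measurable (X t)
  start_zero : ∀ᵐ ω ∂P, X 0 ω = 0
  indep_increments : HasIndepIncrements X P
  stationary_increments : ∀ s t : ℝ≥0,
    IdentDistrib (fun ω => X (s + t) ω - X s ω) (X t) P P
  stochastically_continuous : ∀ t, TendstoInMeasure P X (𝓝 t) (X t)
  cadlag : ∀ᵐ ω ∂P, IsCadlag (fun t => X t ω)

/-- A subordinator: a real-valued Lévy process with almost surely nondecreasing paths. -/
structure IsSubordinator {Ω : Type*} [MeasurableSpace Ω] (T : ℝ≥0 → Ω → ℝ)
    (P : Measure Ω) : Prop extends IsLevyProcess T P where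
  monotone_paths : ∀ᵐ ω ∂P, Monotone (fun t => T t ω)

/-- `Ψ_c^α(u) = (2 c^β u + (m c^γ)^{2/α})^{α/2} - m c^γ`. -/
noncomputable def relPsi (α β γ m c u : ℝ) : ℝ :=
  (2 * c ^ β * u + (m * c ^ γ) ^ (2 / α)) ^ (α / 2) - m * c ^ γ

/-- An `α/2`-relativistic subordinator with parameter `c`: a subordinator with
`E[exp (-u T_t)] = exp (-t Ψ_c^α(u))` for all `t, u ≥ 0`. -/
structure IsRelativisticSubordinator {Ω : Type*} [MeasurableSpace Ω] (α β γ m c : ℝ)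
    (T : ℝ≥0 → Ω → ℝ) (P : Measure Ω) : Prop extends IsSubordinator T P where
  laplace : ∀ (t : ℝ≥0) (u : ℝ), 0 ≤ u →
    ∫ ω, Real.exp (-u * T t ω) ∂P = Real.exp (-(t : ℝ) * relPsi α β γ m c u)

end RelSub

/-! The function `exp (-t Ψ_c(-z))` is holomorphic for `Re z < R_c`, where `R_c = (m c^γ)^(2/α) / (2
c^β)`. As `T_t^c ≥ 0`, its moment generating function exists and has this value on `[-1, R_c)`
(`integrable_exp_mul_and_mgf_eq_of_differentiableOn`). This gives all moments, and `R_c → ∞`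
(`tendsto_radius`) makes `±1` admissible for large `c`. With `a = α t / m^(2/α-1)`, `tendsto_relPsi`
shows that the values at `±1` tend to `exp (±a)`, so `E[cosh (T_t^c - a)] - 1 → 0`. This quantity
controls every absolute moment about `a` (`sq_integral_abs_pow_le`). -/

namespace RelSub

/-- Continuation of the moment generating function of a nonnegative random variable: it exists as
far to the right as its values on the negative half-line extend holomorphically. -/
theorem integrable_exp_mul_and_mgf_eq_of_differentiableOn {Ω : Type*} [MeasurableSpace Ω]
    {P : Measure Ω} [IsFiniteMeasure P] {X : Ω → ℝ} (hX : AEMeasurable X P)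
    (hX0 : ∀ᵐ ω ∂P, 0 ≤ X ω) {G : ℂ → ℂ} {R : ℝ} (hR : 0 < R)
    (hG : DifferentiableOn ℂ G {z | z.re < R})
    (hmgf : ∀ x : ℝ, x < 0 → (mgf X P x : ℂ) = G x) {θ : ℝ} (hθ0 : -1 ≤ θ) (hθ : θ < R) :
    Integrable (fun ω => Real.exp (θ * X ω)) P ∧ mgf X P θ = (G θ).re := by
  have hneg : ∀ x : ℝ, x ≤ 0 → x ∈ integrableExpSet X P := by
    intro x hx
    refine Integrable.of_bound (C := 1) (by fun_prop) ?_
    filter_upwards [hX0] with ω hω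
    rw [Real.norm_eq_abs, Real.abs_exp, Real.exp_le_one_iff]
    exact mul_nonpos_of_nonpos_of_nonneg hx hω
  have hint : (-1 : ℝ) ∈ interior (integrableExpSet X P) :=
    mem_interior.2 ⟨Set.Iio 0, fun x hx => hneg x (le_of_lt hx), isOpen_Iio, by simp⟩
  have hopen : IsOpen {z : ℂ | z.re < R} := isOpen_lt Complex.continuous_re continuous_const
  have hGan : AnalyticAt ℂ G (-1) :=
    hG.analyticAt (hopen.mem_nhds (by simp; linarith))
  have hMan : AnalyticAt ℂ (complexMGF X P) (-1) := analyticAt_complexMGF (by simpa using hint)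
  -- Identity theorem: the two functions agree at real points accumulating at `-1`.
  have heq : complexMGF X P =ᶠ[𝓝 (-1)] G := by
    refine (hMan.frequently_eq_iff_eventually_eq hGan).1 ?_
    have hseq : Tendsto (fun x : ℝ => (x : ℂ)) (𝓝[≠] (-1)) (𝓝[≠] (-1)) := by
      refine tendsto_nhdsWithin_iff.2 ⟨?_, ?_⟩
      · have : Tendsto (fun x : ℝ => (x : ℂ)) (𝓝 (-1)) (𝓝 (((-1 : ℝ)) : ℂ)) :=
          Complex.continuous_ofReal.tendsto _
        simpa using this.mono_left nhdsWithin_le_nhds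
      · filter_upwards [self_mem_nhdsWithin] with x hx h
        exact hx (by simpa using congrArg Complex.re h)
    refine hseq.frequently (Eventually.frequently ?_)
    filter_upwards [mem_nhdsWithin_of_mem_nhds (Iio_mem_nhds (by norm_num : (-1 : ℝ) < 0))]
      with x hx
    rw [complexMGF_ofReal, hmgf x hx]
  have hderiv : ∀ k : ℕ, iteratedDeriv k G (-1)
      = ((∫ ω, X ω ^ k * Real.exp (-1 * X ω) ∂P : ℝ) : ℂ) := by
    intro k
    rw [← heq.iteratedDeriv_eq k, iteratedDeriv_complexMGF (by simpa using hint),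
      ← integral_complex_ofReal]
    simp
  have hball : Metric.ball (-1 : ℂ) (R + 1) ⊆ {z : ℂ | z.re < R} := by
    intro z hz
    have h1 := (Complex.abs_re_le_norm (z - -1)).trans_lt (mem_ball_iff_norm.1 hz)
    have h2 := (le_abs_self _).trans_lt h1
    simp at h2
    simpa using h2
  have htaylor := Complex.hasSum_taylorSeries_on_ball (hG.mono hball) (z := (θ : ℂ)) (by
    rw [mem_ball_iff_norm, sub_neg_eq_add,
      show (θ : ℂ) + 1 = ((θ + 1 : ℝ) : ℂ) by push_cast; rfl, Complex.norm_real,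
      Real.norm_eq_abs, abs_of_nonneg (by linarith)]
    linarith)
  -- Expanding `exp (θ X) = exp ((θ + 1) X) exp (-X)` gives terms that are nonnegative because `θ ≥
  -- -1` and `X ≥ 0`. Tonelli then equates the integral with the Taylor series of `G` at `-1`,
  -- without assuming integrability.
  set F : ℕ → Ω → ℝ := fun k ω =>
    ((k.factorial : ℝ))⁻¹ * (θ + 1) ^ k * (X ω ^ k * Real.exp (-1 * X ω)) with hF
  have hFint : ∀ k, Integrable (F k) P := fun k =>
    (integrable_pow_mul_exp_of_mem_interior_integrableExpSet hint k).const_mul _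
  have hF0 : ∀ k, 0 ≤ᵐ[P] F k := fun k => by
    filter_upwards [hX0] with ω hω
    have : 0 ≤ θ + 1 := by linarith
    simp only [hF, Pi.zero_apply]
    positivity
  have hsum : HasSum (fun k => ∫ ω, F k ω ∂P) (G θ).re := by
    have := Complex.hasSum_re htaylor
    convert this using 2 with k
    rw [hderiv k, hF, integral_const_mul, smul_eq_mul, smul_eq_mul,
      show (k.factorial : ℂ)⁻¹ * (((θ : ℂ) - -1) ^ k *
        ((∫ ω, X ω ^ k * Real.exp (-1 * X ω) ∂P : ℝ) : ℂ)) =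
        (((k.factorial : ℝ)⁻¹ * (θ + 1) ^ k * ∫ ω, X ω ^ k * Real.exp (-1 * X ω) ∂P : ℝ) : ℂ) by
        push_cast; ring, Complex.ofReal_re]
  have hpt : ∀ ω, HasSum (fun k => F k ω) (Real.exp (θ * X ω)) := by
    intro ω
    have h := (NormedSpace.expSeries_div_hasSum_exp ((θ + 1) * X ω)).mul_right
      (Real.exp (-1 * X ω))
    rw [← Real.exp_eq_exp_ℝ, ← Real.exp_add,
      show (θ + 1) * X ω + -1 * X ω = θ * X ω by ring] at h
    have hFk : (fun k => F k ω) =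
        fun k : ℕ => ((θ + 1) * X ω) ^ k / (k.factorial : ℝ) * Real.exp (-1 * X ω) := by
      ext k
      simp only [hF, mul_pow]
      ring
    rw [hFk]
    exact h
  have hlint : ∫⁻ ω, ENNReal.ofReal (Real.exp (θ * X ω)) ∂P = ENNReal.ofReal (G θ).re := by
    have hall : ∀ᵐ ω ∂P, ∀ k, 0 ≤ F k ω := ae_all_iff.2 hF0
    calc ∫⁻ ω, ENNReal.ofReal (Real.exp (θ * X ω)) ∂P
        = ∫⁻ ω, ∑' k, ENNReal.ofReal (F k ω) ∂P := by
          refine lintegral_congr_ae ?_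
          filter_upwards [hall] with ω hω
          rw [← (hpt ω).tsum_eq, ENNReal.ofReal_tsum_of_nonneg hω (hpt ω).summable]
      _ = ∑' k, ∫⁻ ω, ENNReal.ofReal (F k ω) ∂P :=
          lintegral_tsum fun k => (hFint k).aemeasurable.ennreal_ofReal
      _ = ∑' k, ENNReal.ofReal (∫ ω, F k ω ∂P) := by
          congr 1 with k
          rw [ofReal_integral_eq_lintegral_ofReal (hFint k) (hF0 k)]
      _ = ENNReal.ofReal (G θ).re := by
          rw [← hsum.tsum_eq, ENNReal.ofReal_tsum_of_nonneg
            (fun k => integral_nonneg_of_ae (hF0 k)) hsum.summable]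
  have hmeas : AEStronglyMeasurable (fun ω => Real.exp (θ * X ω)) P := by fun_prop
  have hexp0 : 0 ≤ᵐ[P] fun ω => Real.exp (θ * X ω) := ae_of_all _ fun ω => (Real.exp_pos _).le
  refine ⟨⟨hmeas, ?_⟩, ?_⟩
  · rw [hasFiniteIntegral_iff_ofReal hexp0, hlint]
    exact ENNReal.ofReal_lt_top
  · rw [mgf, integral_eq_lintegral_of_nonneg_ae hexp0 hmeas, hlint, ENNReal.toReal_ofReal]
    exact hsum.nonneg fun k => integral_nonneg_of_ae (hF0 k)

theorem pow_two_mul_div_factorial_le_cosh_sub_one {k : ℕ} (hk : 1 ≤ k) (y : ℝ) :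
    y ^ (2 * k) / ((2 * k).factorial : ℝ) ≤ Real.cosh y - 1 := by
  -- All terms of the series are nonnegative; `k ≥ 1` keeps the two retained ones distinct.
  have h := sum_le_hasSum {0, k} (fun i _ => by
    have : 0 ≤ y ^ (2 * i) := (even_two_mul i).pow_nonneg y
    positivity) (Real.hasSum_cosh y)
  rw [Finset.sum_pair (by omega)] at h
  simp at h
  linarith

theorem sq_integral_le_integral_sq {Ω : Type*} [MeasurableSpace Ω] {P : Measure Ω}
    [IsProbabilityMeasure P] {Z : Ω → ℝ} (hZ : MemLp Z 2 P) :
    (∫ ω, Z ω ∂P) ^ 2 ≤ ∫ ω, Z ω ^ 2 ∂P := by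
  have h1 := variance_nonneg Z P
  rw [variance_eq_sub hZ] at h1
  simpa using h1

/-- A quantitative bound on the absolute moments about `a` by the moment generating function
at `±1`. -/
theorem sq_integral_abs_pow_le {Ω : Type*} [MeasurableSpace Ω] {P : Measure Ω}
    [IsProbabilityMeasure P] {X : Ω → ℝ} {a : ℝ} {n : ℕ} (hn : 1 ≤ n)
    (hmom : ∀ k : ℕ, MemLp (fun ω => |X ω - a| ^ k) 2 P)
    (h1 : Integrable (fun ω => Real.exp (1 * X ω)) P)
    (h2 : Integrable (fun ω => Real.exp (-1 * X ω)) P) :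
    (∫ ω, |X ω - a| ^ n ∂P) ^ 2 ≤ ((2 * n).factorial : ℝ) *
      ((Real.exp (-a) * mgf X P 1 + Real.exp a * mgf X P (-1)) / 2 - 1) := by
  have hcosh : ∀ ω, Real.cosh (X ω - a) - 1 =
      (Real.exp (-a) * Real.exp (1 * X ω) + Real.exp a * Real.exp (-1 * X ω)) / 2 - 1 := by
    intro ω
    rw [Real.cosh_eq, ← Real.exp_add, ← Real.exp_add]
    ring_nf
  have hi : Integrable (fun ω =>
      (Real.exp (-a) * Real.exp (1 * X ω) + Real.exp a * Real.exp (-1 * X ω)) / 2) P :=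
    ((h1.const_mul _).add (h2.const_mul _)).div_const 2
  refine (sq_integral_le_integral_sq (hmom n)).trans ?_
  have hval : ∫ ω, ((2 * n).factorial : ℝ) * (Real.cosh (X ω - a) - 1) ∂P =
      ((2 * n).factorial : ℝ) *
        ((Real.exp (-a) * mgf X P 1 + Real.exp a * mgf X P (-1)) / 2 - 1) := by
    simp_rw [hcosh]
    rw [integral_const_mul, integral_sub hi (integrable_const 1), integral_div,
      integral_add (h1.const_mul _) (h2.const_mul _), integral_const_mul, integral_const_mul]
    simp [mgf]
  rw [← hval]
  refine integral_mono (hmom n).integrable_sq ?_ fun ω => ?_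
  · simp_rw [hcosh]
    exact (hi.sub (integrable_const 1)).const_mul _
  · have h := pow_two_mul_div_factorial_le_cosh_sub_one hn (X ω - a)
    rw [div_le_iff₀' (by positivity)] at h
    refine le_trans (le_of_eq ?_) h
    simp only
    rw [← pow_mul, mul_comm n 2, (even_two_mul n).pow_abs]

/-- The holomorphic extension of `x ↦ exp (-t Ψ_c^α(-x))`. -/
noncomputable def relExt (α β γ m c t : ℝ) (z : ℂ) : ℂ :=
  Complex.exp (-(t : ℂ) * ((((-(2 * c ^ β) : ℝ) : ℂ) * z + (((m * c ^ γ) ^ (2 / α) : ℝ) : ℂ))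
    ^ (((α / 2 : ℝ)) : ℂ) - ((m * c ^ γ : ℝ) : ℂ)))

theorem relExt_ofReal {α β γ m c t x : ℝ}
    (hx : 0 ≤ 2 * c ^ β * -x + (m * c ^ γ) ^ (2 / α)) :
    relExt α β γ m c t x = (Real.exp (-t * relPsi α β γ m c (-x)) : ℝ) := by
  have h : (((-(2 * c ^ β) : ℝ) : ℂ) * x + (((m * c ^ γ) ^ (2 / α) : ℝ) : ℂ)) =
      ((2 * c ^ β * -x + (m * c ^ γ) ^ (2 / α) : ℝ) : ℂ) := by push_cast; ring
  rw [relExt, h, ← Complex.ofReal_cpow hx, relPsi]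
  push_cast
  rfl

theorem differentiableOn_relExt (α γ m t : ℝ) {β c : ℝ} (hc : 0 < c) :
    DifferentiableOn ℂ (relExt α β γ m c t)
      {z | z.re < (m * c ^ γ) ^ (2 / α) / (2 * c ^ β)} := by
  intro z hz
  have hcβ : 0 < 2 * c ^ β := by positivity
  have hz' : z.re * (2 * c ^ β) < (m * c ^ γ) ^ (2 / α) := (lt_div_iff₀ hcβ).1 hz
  refine DifferentiableAt.differentiableWithinAt ?_
  unfold relExt
  -- The base of the power has positive real part, hence avoids the branch cut.
  refine DifferentiableAt.cexp (DifferentiableAt.const_mul (DifferentiableAt.sub_const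
    (DifferentiableAt.cpow_const (by fun_prop) (Or.inl ?_)) _) _)
  rw [Complex.add_re, Complex.re_ofReal_mul, Complex.ofReal_re]
  linarith

section

variable {Ω : Type*} [MeasurableSpace Ω] {P : Measure Ω} {α β γ m c : ℝ} {T : ℝ≥0 → Ω → ℝ}

theorem IsSubordinator.ae_nonneg (hT : IsSubordinator T P) (t : ℝ≥0) :
    ∀ᵐ ω ∂P, 0 ≤ T t ω := by
  filter_upwards [hT.start_zero, hT.monotone_paths] with ω h0 hmono
  exact h0 ▸ hmono (zero_le : 0 ≤ t)

theorem IsRelativisticSubordinator.integrable_exp_mul_and_mgf_eq [IsProbabilityMeasure P]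
    (hT : IsRelativisticSubordinator α β γ m c T P) (hm : 0 < m) (hc : 0 < c) (t : ℝ≥0)
    {θ : ℝ} (hθ0 : -1 ≤ θ) (hθ : θ < (m * c ^ γ) ^ (2 / α) / (2 * c ^ β)) :
    Integrable (fun ω => Real.exp (θ * T t ω)) P ∧
      mgf (T t) P θ = Real.exp (-t * relPsi α β γ m c (-θ)) := by
  have hcβ : 0 < 2 * c ^ β := by positivity
  have hD : 0 < (m * c ^ γ) ^ (2 / α) := by positivity
  have hb : ∀ x : ℝ, x < (m * c ^ γ) ^ (2 / α) / (2 * c ^ β) →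
      0 ≤ 2 * c ^ β * -x + (m * c ^ γ) ^ (2 / α) := by
    intro x hx
    have := (lt_div_iff₀ hcβ).1 hx
    linarith
  have h := integrable_exp_mul_and_mgf_eq_of_differentiableOn (hT.measurable t).aemeasurable
    (hT.toIsSubordinator.ae_nonneg t) (div_pos hD hcβ)
    (differentiableOn_relExt α γ m t hc) (fun x hx => by
      rw [relExt_ofReal (hb x (hx.trans (div_pos hD hcβ))), ← hT.laplace t (-x) (by linarith),
        mgf, neg_neg]) hθ0 hθ
  refine ⟨h.1, ?_⟩
  rw [h.2, relExt_ofReal (hb θ hθ), Complex.ofReal_re]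

theorem IsRelativisticSubordinator.memLp [IsProbabilityMeasure P]
    (hT : IsRelativisticSubordinator α β γ m c T P) (hm : 0 < m) (hc : 0 < c) (t : ℝ≥0)
    (p : ℝ≥0) : MemLp (T t) p P := by
  refine memLp_of_mem_interior_integrableExpSet (mem_interior.2 ⟨Set.Ioo (-1)
    ((m * c ^ γ) ^ (2 / α) / (2 * c ^ β)), fun θ hθ =>
      (hT.integrable_exp_mul_and_mgf_eq hm hc t hθ.1.le hθ.2).1, isOpen_Ioo, by simp, ?_⟩) p
  positivity

theorem IsRelativisticSubordinator.memLp_abs_sub_pow [IsProbabilityMeasure P]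
    (hT : IsRelativisticSubordinator α β γ m c T P) (hm : 0 < m) (hc : 0 < c) (t : ℝ≥0)
    (a : ℝ) (k : ℕ) : MemLp (fun ω => |T t ω - a| ^ k) 2 P := by
  have h : MemLp (fun ω => T t ω - a) ((2 * k : ℝ≥0) : ENNReal) P :=
    (hT.memLp hm hc t (2 * k)).sub (memLp_const a)
  rcases Nat.eq_zero_or_pos k with rfl | hk
  · simpa using memLp_const (1 : ℝ)
  have h' := h.norm_rpow_div (k : ENNReal)
  have hk' : (k : ENNReal) ≠ 0 := by simpa using hk.ne'
  simpa [ENNReal.mul_div_cancel_right hk'] using h'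

end

section

variable {α β γ m : ℝ}

/-- The relation between the exponents gives `(c^γ)^(2/α) = c^(β+γ)`. With `x = c^(-γ)`, `Ψ_c(u)` is
then `m` times the difference quotient at `0` of `(1 + 2 u m^(-2/α) x)^(α/2)`. -/
theorem tendsto_relPsi (hα : 0 < α) (hγ : 0 < γ) (hm : 0 < m)
    (h : 2 * γ = α * (β + γ)) (u : ℝ) :
    Tendsto (fun c => relPsi α β γ m c u) atTop (𝓝 (α * u / m ^ (2 / α - 1))) := by
  have hder : HasDerivAt (fun x : ℝ => (1 + 2 * u / m ^ (2 / α) * x) ^ (α / 2))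
      (α * u / m ^ (2 / α)) 0 := by
    have h1 : HasDerivAt (fun x : ℝ => 1 + 2 * u / m ^ (2 / α) * x) (2 * u / m ^ (2 / α)) 0 := by
      simpa using ((hasDerivAt_id (0 : ℝ)).const_mul (2 * u / m ^ (2 / α))).const_add 1
    convert h1.rpow_const (p := α / 2) (by simp) using 1
    simp
    ring
  have hslope := hder.tendsto_slope_zero_right.comp
    (tendsto_inv_atTop_nhdsGT_zero.comp (tendsto_rpow_atTop hγ))
  have hlim := hslope.const_mul m
  have hval : m * (α * u / m ^ (2 / α)) = α * u / m ^ (2 / α - 1) := by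
    rw [Real.rpow_sub_one hm.ne']
    field_simp
  rw [hval] at hlim
  have hlarge : Tendsto (fun c : ℝ => 1 + 2 * u / m ^ (2 / α) * (c ^ γ)⁻¹) atTop (𝓝 1) := by
    simpa using ((tendsto_inv_atTop_zero.comp (tendsto_rpow_atTop hγ)).const_mul
      (2 * u / m ^ (2 / α))).const_add 1
  refine hlim.congr' ?_
  filter_upwards [eventually_gt_atTop 0, hlarge.eventually (lt_mem_nhds one_pos)] with c hc hpos
  have hv : 0 < c ^ γ := by positivity
  have hD : (m * c ^ γ) ^ (2 / α) = m ^ (2 / α) * (c ^ β * c ^ γ) := by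
    rw [Real.mul_rpow hm.le hv.le, ← Real.rpow_mul hc.le, ← Real.rpow_add hc]
    congr 2
    field_simp
    linarith
  have hbase : 2 * c ^ β * u + (m * c ^ γ) ^ (2 / α) =
      (m * c ^ γ) ^ (2 / α) * (1 + 2 * u / m ^ (2 / α) * (c ^ γ)⁻¹) := by
    rw [hD]
    field_simp
    ring
  rw [relPsi, hbase, Real.mul_rpow (by positivity) hpos.le, ← Real.rpow_mul (by positivity),
    show 2 / α * (α / 2) = 1 by field_simp, Real.rpow_one]
  simp
  ring

/-- The same relation reduces the quotient to `m^(2/α) c^γ / 2`. -/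
theorem tendsto_radius (hα : 0 < α) (hγ : 0 < γ) (hm : 0 < m)
    (h : 2 * γ = α * (β + γ)) :
    Tendsto (fun c : ℝ => (m * c ^ γ) ^ (2 / α) / (2 * c ^ β)) atTop atTop := by
  have hlim := (tendsto_rpow_atTop hγ).const_mul_atTop
    (show 0 < m ^ (2 / α) / 2 by positivity)
  refine hlim.congr' ?_
  filter_upwards [eventually_gt_atTop 0] with c hc
  have hv : 0 < c ^ γ := by positivity
  have hD : (m * c ^ γ) ^ (2 / α) = m ^ (2 / α) * (c ^ β * c ^ γ) := by
    rw [Real.mul_rpow hm.le hv.le, ← Real.rpow_mul hc.le, ← Real.rpow_add hc]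
    congr 2
    field_simp
    linarith
  rw [hD]
  field_simp

end

end RelSub

theorem corollary2p5 {Ω : Type*} [MeasurableSpace Ω] (P : Measure Ω) [IsProbabilityMeasure P]
    (α β γ m : ℝ) (hα : 0 < α) (hα2 : α < 2) (hβ : 0 < β) (hγ : 0 < γ) (hm : 0 < m)
    (hαβγ : 2 * γ = α * (β + γ))
    (T : ℝ → ℝ≥0 → Ω → ℝ)
    (hT : ∀ c : ℝ, 0 < c → RelSub.IsRelativisticSubordinator α β γ m c (T c) P)
    (t : ℝ≥0) (n : ℕ) (hn : 1 ≤ n) :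
    (∀ c : ℝ, 0 < c →
      Integrable (fun ω => |T c t ω - α * t / m ^ (2 / α - 1)| ^ n) P) ∧
    Tendsto (fun c : ℝ => ∫ ω, |T c t ω - α * t / m ^ (2 / α - 1)| ^ n ∂P) atTop (𝓝 0) := by
  set a : ℝ := α * t / m ^ (2 / α - 1) with ha
  have hmom := fun (c : ℝ) (hc : 0 < c) => (hT c hc).memLp_abs_sub_pow hm hc t a
  refine ⟨fun c hc => (hmom c hc n).integrable one_le_two, ?_⟩
  have hlim : ∀ θ : ℝ, Tendsto
      (fun c => Real.exp (-t * RelSub.relPsi α β γ m c (-θ))) atTop (𝓝 (Real.exp (θ * a))) := by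
    intro θ
    have h := (Real.continuous_exp.tendsto _).comp
      ((RelSub.tendsto_relPsi hα hγ hm hαβγ (-θ)).const_mul (-(t : ℝ)))
    rwa [show -(t : ℝ) * (α * -θ / m ^ (2 / α - 1)) = θ * a by rw [ha]; ring] at h
  have hbound : Tendsto (fun c => ((2 * n).factorial : ℝ) *
      ((Real.exp (-a) * Real.exp (-t * RelSub.relPsi α β γ m c (-1)) +
        Real.exp a * Real.exp (-t * RelSub.relPsi α β γ m c (- -1))) / 2 - 1)) atTop (𝓝 0) := by
    have h := ((((hlim 1).const_mul (Real.exp (-a))).add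
      ((hlim (-1)).const_mul (Real.exp a))).div_const 2).sub_const 1 |>.const_mul
      ((2 * n).factorial : ℝ)
    rw [← Real.exp_add, ← Real.exp_add] at h
    simpa using h
  have hsq : Tendsto (fun c : ℝ => (∫ ω, |T c t ω - a| ^ n ∂P) ^ 2) atTop (𝓝 0) := by
    refine squeeze_zero' (Eventually.of_forall fun c => sq_nonneg _) ?_ hbound
    filter_upwards [eventually_gt_atTop 0,
      (RelSub.tendsto_radius hα hγ hm hαβγ).eventually_gt_atTop 1] with c hc hr
    have h1 := (hT c hc).integrable_exp_mul_and_mgf_eq hm hc t (by norm_num) hr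
    have h2 := (hT c hc).integrable_exp_mul_and_mgf_eq hm hc t le_rfl
      (by linarith : (-1 : ℝ) < _)
    rw [← h1.2, ← h2.2]
    exact RelSub.sq_integral_abs_pow_le hn (hmom c hc) h1.1 h2.1
  have h := hsq.sqrt
  rw [Real.sqrt_zero] at h
  refine h.congr fun c => Real.sqrt_sq (integral_nonneg fun ω => by positivity)
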